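/- Let $p$ be a prime, let $P=\mathbb F_p[x,y]$, and let $SL_2(\mathbb F_p)$ act on $P$ by $\mathbb F_p$-algebra automorphisms extending its linear action on $\mathbb F_p^2$ with standard basis $x,y$; that is, $gx=g_{11}x+g_{21}y$ and $gy=g_{12}x+g_{22}y$. Put $$\delta=xy^p-x^py,\qquad d_1=\frac{xy^{p^2}-x^{p^2}y}{\delta},\qquad \mu=x^{p-1}y^{p^2-p},$$ $$\gamma_i=x^{i(p-1)}-x^{p-1}y^{(i-1)(p-1)}+y^{i(p-1)}\quad(i\ge 1).$$ Let $J=\langle d_1,\delta,\mu,\gamma_2,\dots,\gamma_{p-1}\rangle\subseteq P$ (with no $\gamma_i$ in the list if $p=2$) and $Q=P/J$. Then: 1. $J=\langle d_1,\delta,\gamma_2,x^{p-1}y^{2p-2}\rangle$, so that $Q=P/\langle d_1,\delta,\gamma_2,x^{p-1}y^{2p-2}\rangle$. 2. The classes in $Q$ of the monomials in $$\Theta=\{x^iy^j \mid 0\le i\le p-1,\ 0\le j\le 2p-2,\ i+j\ne 3p-3\}\cup\{x^i\mid p\le i\le 2p-3\}$$ are pairwise distinct and form an $\mathbb F_p$-basis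 of $Q$. 3. The ideal $J$ is stable under $SL_2(\mathbb F_p)$, and for the induced action $Q$ has no nonzero invariants of positive degree: if $f\in P$ has zero constant term and its class in $Q$ is $SL_2(\mathbb F_p)$-invariant, then this class is $0$. -/

import Mathlib

open MvPolynomial

noncomputable section

namespace StableInv

/-- The polynomial ring `P = 𝔽_p[x, y]`. -/
abbrev P (p : ℕ) : Type := MvPolynomial (Fin 2) (ZMod p)

/-- The variable `x`. -/
abbrev x (p : ℕ) : P p := X 0

/-- The variable `y`. -/
abbrev y (p : ℕ) : P p := X 1

/-- `δ = x y^p - x^p y`. -/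
def delta (p : ℕ) : P p := x p * y p ^ p - x p ^ p * y p

/-- The identity showing that `δ` divides `x y^(p^2) - x^(p^2) y`. -/
theorem delta_mul_sum (p : ℕ) [Fact p.Prime] :
    delta p * ∑ i ∈ Finset.range (p + 1), x p ^ ((p - 1) * i) * y p ^ ((p - 1) * (p - i)) =
      x p * y p ^ (p ^ 2) - x p ^ (p ^ 2) * y p := by
  obtain ⟨q, hq⟩ : ∃ q, p = q + 1 := ⟨p - 1, by have := (Fact.out : p.Prime).pos; omega⟩
  have h := (Commute.all (x p ^ (p - 1)) (y p ^ (p - 1))).geom_sum₂_mul (p + 1)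
  have h1 : ∑ i ∈ Finset.range (p + 1), x p ^ ((p - 1) * i) * y p ^ ((p - 1) * (p - i)) =
      ∑ i ∈ Finset.range (p + 1),
        (x p ^ (p - 1)) ^ i * (y p ^ (p - 1)) ^ (p + 1 - 1 - i) := by
    refine Finset.sum_congr rfl fun i _ => ?_
    rw [pow_mul, pow_mul, Nat.add_sub_cancel]
  have hd : delta p = -(x p * y p * (x p ^ (p - 1) - y p ^ (p - 1))) := by
    have hx : x p ^ p = x p * x p ^ (p - 1) := by
      rw [← pow_succ', Nat.sub_add_cancel (Fact.out : p.Prime).one_le]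
    have hy : y p ^ p = y p * y p ^ (p - 1) := by
      rw [← pow_succ', Nat.sub_add_cancel (Fact.out : p.Prime).one_le]
    rw [delta, hx, hy]
    ring
  have he : p ^ 2 = (p - 1) * (p + 1) + 1 := by
    rw [hq, Nat.add_sub_cancel]
    ring
  have hx2 : x p ^ (p ^ 2) = x p * (x p ^ (p - 1)) ^ (p + 1) := by
    rw [← pow_mul, ← pow_succ', ← he]
  have hy2 : y p ^ (p ^ 2) = y p * (y p ^ (p - 1)) ^ (p + 1) := by
    rw [← pow_mul, ← pow_succ', ← he]
  rw [h1, hd, hx2, hy2]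
  linear_combination (-(x p * y p)) * h

theorem delta_dvd (p : ℕ) [Fact p.Prime] :
    delta p ∣ x p * y p ^ (p ^ 2) - x p ^ (p ^ 2) * y p :=
  ⟨_, (delta_mul_sum p).symm⟩

/-- The Dickson polynomial `d₁ = (x y^(p^2) - x^(p^2) y) / δ` (exact quotient in the domain `P`). -/
def d1 (p : ℕ) [Fact p.Prime] : P p := Classical.choose (delta_dvd p)

theorem delta_mul_d1 (p : ℕ) [Fact p.Prime] :
    delta p * d1 p = x p * y p ^ (p ^ 2) - x p ^ (p ^ 2) * y p :=
  (Classical.choose_spec (delta_dvd p)).symm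

/-- The exact quotient is unique, because `δ ≠ 0`. -/
theorem delta_ne_zero (p : ℕ) [Fact p.Prime] : delta p ≠ 0 := by
  intro h
  have hp := (Fact.out : p.Prime).one_lt
  have h2 : coeff (Finsupp.single 0 1 + Finsupp.single 1 p) (delta p) = 1 := by
    have e1 : x p * y p ^ p =
        monomial (Finsupp.single (0 : Fin 2) 1 + Finsupp.single 1 p) (1 : ZMod p) := by
      rw [monomial_eq, Finsupp.prod_add_index' (by simp) (by intros; rw [pow_add])]
      simp
    have e2 : x p ^ p * y p =
        monomial (Finsupp.single (0 : Fin 2) p + Finsupp.single 1 1) (1 : ZMod p) := by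
      rw [monomial_eq, Finsupp.prod_add_index' (by simp) (by intros; rw [pow_add])]
      simp
    rw [delta, e1, e2, coeff_sub, coeff_monomial, coeff_monomial, if_pos rfl, if_neg, sub_zero]
    intro h3
    have h4 := DFunLike.congr_fun h3 0
    simp at h4
    omega
  rw [h, coeff_zero] at h2
  exact zero_ne_one h2

/-- The fundamental class `μ = x^(p-1) y^(p^2-p)`. -/
def mu (p : ℕ) : P p := x p ^ (p - 1) * y p ^ (p ^ 2 - p)

/-- `γ_i = x^(i(p-1)) - x^(p-1) y^((i-1)(p-1)) + y^(i(p-1))`, for `i ≥ 1`. -/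
def gam (p i : ℕ) : P p :=
  x p ^ (i * (p - 1)) - x p ^ (p - 1) * y p ^ ((i - 1) * (p - 1)) + y p ^ (i * (p - 1))

/-- The ideal `⟨d₁, δ, μ, γ_2, …, γ_{p-1}⟩`. -/
def J (p : ℕ) [Fact p.Prime] : Ideal (P p) :=
  Ideal.span ({d1 p, delta p, mu p} ∪ gam p '' Set.Icc 2 (p - 1))

/-- The quotient ring `Q = P / ⟨d₁, δ, μ, γ_2, …, γ_{p-1}⟩`. -/
abbrev Q (p : ℕ) [Fact p.Prime] : Type := P p ⧸ J p

/-- The exponents `(i, j)` of the monomials `x^i y^j` in `Θ`. -/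
def Theta (p : ℕ) : Set (ℕ × ℕ) :=
  {t | t.1 ≤ p - 1 ∧ t.2 ≤ 2 * p - 2 ∧ t.1 + t.2 ≠ 3 * p - 3} ∪
    {t | p ≤ t.1 ∧ t.1 ≤ 2 * p - 3 ∧ t.2 = 0}

/-- The action of `SL_2(𝔽_p)` on `P` by algebra automorphisms: `x, y` is the standard basis
of `𝔽_p^2`, and `g` acts linearly on it, so `g x = g₀₀ x + g₁₀ y` and `g y = g₀₁ x + g₁₁ y`. -/
def act (p : ℕ) (g : Matrix.SpecialLinearGroup (Fin 2) (ZMod p)) : P p →ₐ[ZMod p] P p :=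
  aeval fun j => ∑ i, C (g.1 i j) * X i

end StableInv

end

open MvPolynomial

noncomputable section

namespace StableInv

/-! Write a = x^(p-1), b = y^(p-1). Modulo δ one has ab(a - b) = 0, and γ₂ gives a² - ab + b² = 0;
together they force a³ = b³ = 0. With ab² = 0 this kills every γ_i and, up to the small primes,
every term of d₁. Conversely γ₃ (or d₁ when p = 3, μ when p = 2) recovers ab². Hence
`J_eq_span_smallGens`.

For the basis, δ moves p - 1 from one exponent to the other when both are positive, so such a
monomial is determined modulo δ by its degree and by i mod p - 1. The resulting rewriting rule
extends to a linear map `normalForm` that kills J, fixes Θ and changes polynomials only modulo J, so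
J is its kernel.

The action is studied through values on 𝔽_p²: δ vanishes at every point, γ₂ equals 1 off the origin,
and forms of degree below 2p - 2 have point sum 0. In degrees d < 2p - 2, membership in J means
vanishing at all points. In degrees 2p - 2 ≤ d < 3p - 3, it means orthogonality, under (f, h) ↦ ∑
f(v)h(v), to all forms h of degree 3p - 3 - d. From degree 3p - 3 on, everything lies in J. These
criteria give stability. An invariant class of low positive degree is constant on nonzero vectors by
transitivity, and its point sum forces the constant to be 0. In the middle range it gives an
invariant functional on binary forms of degree between 1 and p - 1, which must vanish. -/

theorem d1_eq_sum (p : ℕ) [Fact p.Prime] :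
    d1 p = ∑ i ∈ Finset.range (p + 1), x p ^ ((p - 1) * i) * y p ^ ((p - 1) * (p - i)) :=
  mul_left_cancel₀ (delta_ne_zero p) ((delta_mul_d1 p).trans (delta_mul_sum p).symm)

/-- The generators `δ, γ₂, x^(p-1) y^(2p-2)` of `J`. -/
def smallGens (p : ℕ) : Set (P p) :=
  {delta p, gam p 2, x p ^ (p - 1) * y p ^ (2 * p - 2)}

/-! ### Generators of J -/

section Relations

variable {R : Type*} [CommRing R] {a b : R}

/-- In this section a and b stand for the classes of x^(p-1) and y^(p-1): `h1` comes from δ, `h2`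
from γ₂, and `h3` from x^(p-1) y^(2p-2). -/
theorem cube_eq_zero_left (h1 : a * b * a = a * b * b) (h2 : a ^ 2 - a * b + b ^ 2 = 0) :
    a ^ 3 = 0 := by
  linear_combination a * h2 + h1

theorem cube_eq_zero_right (h1 : a * b * a = a * b * b) (h2 : a ^ 2 - a * b + b ^ 2 = 0) :
    b ^ 3 = 0 := by
  linear_combination b * h2 - h1

theorem pow_mul_pow_eq_zero (h1 : a * b * a = a * b * b) (h3 : a * b ^ 2 = 0) {i j : ℕ}
    (hi : 1 ≤ i) (hj : 1 ≤ j) (hij : 3 ≤ i + j) : a ^ i * b ^ j = 0 := by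
  obtain ⟨i, rfl⟩ := Nat.exists_eq_add_of_le' hi
  obtain ⟨j, rfl⟩ := Nat.exists_eq_add_of_le' hj
  rcases j with _ | j
  · obtain ⟨i, rfl⟩ := Nat.exists_eq_add_of_le' (show 1 ≤ i by omega)
    linear_combination a ^ i * h1 + a ^ i * h3
  · linear_combination a ^ i * b ^ j * h3

theorem gam_relation (h1 : a * b * a = a * b * b) (h2 : a ^ 2 - a * b + b ^ 2 = 0)
    (h3 : a * b ^ 2 = 0) {i : ℕ} (hi : 2 ≤ i) : a ^ i - a * b ^ (i - 1) + b ^ i = 0 := by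
  rcases hi.eq_or_lt with rfl | hi
  · simpa using h2
  · have ha : a ^ i = 0 := pow_eq_zero_of_le hi (cube_eq_zero_left h1 h2)
    have hb : b ^ i = 0 := pow_eq_zero_of_le hi (cube_eq_zero_right h1 h2)
    have hab : a ^ 1 * b ^ (i - 1) = 0 :=
      pow_mul_pow_eq_zero h1 h3 le_rfl (by omega) (by omega)
    rw [pow_one] at hab
    rw [ha, hb, hab]
    ring

/-- With n = p the sum is d₁. For n = 2 the middle term ab survives, so p = 2 needs a separate
argument. -/
theorem geom_sum_relation (h1 : a * b * a = a * b * b) (h2 : a ^ 2 - a * b + b ^ 2 = 0)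
    (h3 : a * b ^ 2 = 0) {n : ℕ} (hn : 3 ≤ n) :
    ∑ i ∈ Finset.range (n + 1), a ^ i * b ^ (n - i) = 0 := by
  refine Finset.sum_eq_zero fun i hi => ?_
  have hi := Finset.mem_range.1 hi
  rcases Nat.eq_zero_or_pos i with rfl | h0
  · simp [pow_eq_zero_of_le hn (cube_eq_zero_right h1 h2)]
  rcases (Nat.lt_succ_iff.1 hi).eq_or_lt with rfl | h
  · simp [pow_eq_zero_of_le hn (cube_eq_zero_left h1 h2)]
  · exact pow_mul_pow_eq_zero h1 h3 h0 (by omega) (by omega)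

theorem geom_sum_eq_of_eq_two {n : ℕ} (hn : n = 2) :
    ∑ i ∈ Finset.range (n + 1), a ^ i * b ^ (n - i) = a ^ 2 + a * b + b ^ 2 := by
  subst hn
  simp [Finset.sum_range_succ]
  ring

theorem geom_sum_eq_of_eq_three {n : ℕ} (hn : n = 3) :
    ∑ i ∈ Finset.range (n + 1), a ^ i * b ^ (n - i) =
      a ^ 3 + a ^ 2 * b + a * b ^ 2 + b ^ 3 := by
  subst hn
  simp [Finset.sum_range_succ]
  ring

end Relations

/-- The relation `a * b * a = a * b * b` for `a = x^(p-1)`, `b = y^(p-1)` modulo `δ`. -/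
theorem mul_mul_eq_of_delta {p : ℕ} (hp : 2 ≤ p) {I : Ideal (P p)} (h : delta p ∈ I) :
    Ideal.Quotient.mk I (x p) ^ (p - 1) * Ideal.Quotient.mk I (y p) ^ (p - 1) *
        Ideal.Quotient.mk I (x p) ^ (p - 1) =
      Ideal.Quotient.mk I (x p) ^ (p - 1) * Ideal.Quotient.mk I (y p) ^ (p - 1) *
        Ideal.Quotient.mk I (y p) ^ (p - 1) := by
  have h := Ideal.Quotient.eq_zero_iff_mem.2 h
  simp only [delta, map_sub, map_mul, map_pow] at h
  obtain ⟨n, rfl⟩ := Nat.exists_eq_add_of_le' hp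
  simp only [show n + 2 - 1 = n + 1 from rfl]
  set X := Ideal.Quotient.mk I (x (n + 2))
  set Y := Ideal.Quotient.mk I (y (n + 2))
  linear_combination (-(X ^ n * Y ^ n)) * h

theorem mk_gam {p : ℕ} (I : Ideal (P p)) (i : ℕ) :
    Ideal.Quotient.mk I (gam p i) =
      (Ideal.Quotient.mk I (x p) ^ (p - 1)) ^ i -
        Ideal.Quotient.mk I (x p) ^ (p - 1) * (Ideal.Quotient.mk I (y p) ^ (p - 1)) ^ (i - 1) +
        (Ideal.Quotient.mk I (y p) ^ (p - 1)) ^ i := by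
  simp only [gam, map_add, map_sub, map_mul, map_pow, ← pow_mul, mul_comm (p - 1)]

theorem mk_d1 {p : ℕ} [Fact p.Prime] (I : Ideal (P p)) :
    Ideal.Quotient.mk I (d1 p) =
      ∑ i ∈ Finset.range (p + 1), (Ideal.Quotient.mk I (x p) ^ (p - 1)) ^ i *
        (Ideal.Quotient.mk I (y p) ^ (p - 1)) ^ (p - i) := by
  simp only [d1_eq_sum, map_sum, map_mul, map_pow, ← pow_mul]

theorem mk_top {p : ℕ} (I : Ideal (P p)) :
    Ideal.Quotient.mk I (x p ^ (p - 1) * y p ^ (2 * p - 2)) =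
      Ideal.Quotient.mk I (x p) ^ (p - 1) * (Ideal.Quotient.mk I (y p) ^ (p - 1)) ^ 2 := by
  rw [map_mul, map_pow, map_pow, ← pow_mul, show 2 * p - 2 = (p - 1) * 2 by omega]

theorem two_eq_zero_of_eq_two {p : ℕ} (hp : p = 2) (I : Ideal (P p)) : (2 : P p ⧸ I) = 0 := by
  subst hp
  have : ((2 : ℕ) : P 2) = 0 := CharP.cast_eq_zero _ 2
  have h := congrArg (Ideal.Quotient.mk I) this
  rw [map_natCast, map_zero] at h
  exact_mod_cast h

theorem d1_mem_of {p : ℕ} [hp : Fact p.Prime] {I : Ideal (P p)} (hδ : delta p ∈ I)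
    (hγ : gam p 2 ∈ I) (hμ : x p ^ (p - 1) * y p ^ (2 * p - 2) ∈ I) : d1 p ∈ I := by
  have h1 := mul_mul_eq_of_delta hp.out.two_le hδ
  have h2 := Ideal.Quotient.eq_zero_iff_mem.2 hγ
  have h3 := Ideal.Quotient.eq_zero_iff_mem.2 hμ
  rw [mk_gam] at h2
  rw [mk_top] at h3
  rw [← Ideal.Quotient.eq_zero_iff_mem, mk_d1]
  rw [show 2 - 1 = 1 from rfl, pow_one] at h2
  -- For p = 2, d₁ = a² + ab + b² agrees with γ₂ because 2 = 0.
  rcases hp.out.two_le.eq_or_lt with h | h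
  · have h20 := two_eq_zero_of_eq_two h.symm I
    generalize Ideal.Quotient.mk I (x p) ^ (p - 1) = a at *
    generalize Ideal.Quotient.mk I (y p) ^ (p - 1) = b at *
    rw [geom_sum_eq_of_eq_two h.symm]
    linear_combination h2 + a * b * h20
  · exact geom_sum_relation h1 h2 h3 h

theorem J_eq_span_smallGens (p : ℕ) [hp : Fact p.Prime] : J p = Ideal.span (smallGens p) := by
  have hp2 := hp.out.two_le
  apply le_antisymm
  · have hδ : delta p ∈ Ideal.span (smallGens p) := Ideal.subset_span (by simp [smallGens])
    have hγ : gam p 2 ∈ Ideal.span (smallGens p) := Ideal.subset_span (by simp [smallGens])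
    have hμ : x p ^ (p - 1) * y p ^ (2 * p - 2) ∈ Ideal.span (smallGens p) :=
      Ideal.subset_span (by simp [smallGens])
    have h1 := mul_mul_eq_of_delta hp2 hδ
    have h2 := Ideal.Quotient.eq_zero_iff_mem.2 hγ
    have h3 := Ideal.Quotient.eq_zero_iff_mem.2 hμ
    rw [mk_gam, show 2 - 1 = 1 from rfl, pow_one] at h2
    rw [mk_top] at h3
    rw [J, Ideal.span_le]
    rintro f ((rfl | rfl | rfl) | ⟨i, hi, rfl⟩)
    · exact d1_mem_of hδ hγ hμ
    · exact hδ
    · have : 2 * p - 2 ≤ p ^ 2 - p := by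
        obtain ⟨n, rfl⟩ := Nat.exists_eq_add_of_le' hp2
        have : (n + 2) ^ 2 = n * n + 4 * n + 4 := by ring
        have : n * n ≥ 0 := Nat.zero_le _
        omega
      rw [mu, ← Nat.sub_add_cancel this, pow_add, mul_left_comm]
      exact Ideal.mul_mem_left _ _ hμ
    · exact Ideal.Quotient.eq_zero_iff_mem.1 (by rw [mk_gam]; exact gam_relation h1 h2 h3 hi.1)
  · have hδ : delta p ∈ J p := Ideal.subset_span (by simp)
    have hd := Ideal.Quotient.eq_zero_iff_mem.2
      (show d1 p ∈ J p from Ideal.subset_span (by simp))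
    rw [mk_d1] at hd
    have h1 := mul_mul_eq_of_delta hp2 hδ
    rcases hp2.eq_or_lt with h | h
    · have h20 := two_eq_zero_of_eq_two h.symm (J p)
      have hγ : gam p 2 ∈ J p := by
        rw [← Ideal.Quotient.eq_zero_iff_mem, mk_gam, show 2 - 1 = 1 from rfl, pow_one]
        generalize Ideal.Quotient.mk (J p) (x p) ^ (p - 1) = a at *
        generalize Ideal.Quotient.mk (J p) (y p) ^ (p - 1) = b at *
        rw [geom_sum_eq_of_eq_two h.symm] at hd
        linear_combination hd - a * b * h20
      -- For p = 2 the exponents p² - p and 2p - 2 coincide, so this monomial is μ.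
      have hμ : x p ^ (p - 1) * y p ^ (2 * p - 2) ∈ J p := by
        have hm : mu p ∈ J p := Ideal.subset_span (by simp)
        subst h
        exact hm
      rw [Ideal.span_le]
      rintro f (rfl | rfl | rfl)
      exacts [hδ, hγ, hμ]
    · have hγ : gam p 2 ∈ J p :=
        Ideal.subset_span (Or.inr ⟨2, ⟨le_rfl, by omega⟩, rfl⟩)
      have h2 := Ideal.Quotient.eq_zero_iff_mem.2 hγ
      rw [mk_gam, show 2 - 1 = 1 from rfl, pow_one] at h2
      have hμ : x p ^ (p - 1) * y p ^ (2 * p - 2) ∈ J p := by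
        rw [← Ideal.Quotient.eq_zero_iff_mem, mk_top]
        have ha := cube_eq_zero_left h1 h2
        have hb := cube_eq_zero_right h1 h2
        -- γ₃ is among the generators only for p > 3. For p = 3, d₁ reduces to 2ab² = -ab² instead.
        rcases Nat.lt_or_ge 3 p with h4 | h4
        · have h3 := Ideal.Quotient.eq_zero_iff_mem.2
            (show gam p 3 ∈ J p from Ideal.subset_span (Or.inr ⟨3, ⟨by omega, by omega⟩, rfl⟩))
          rw [mk_gam, show 3 - 1 = 2 from rfl] at h3
          linear_combination ha + hb - h3
        · have h5 : p = 3 := by omega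
          have h30 : (3 : P p ⧸ J p) = 0 := by
            have : ((p : ℕ) : P p) = 0 := CharP.cast_eq_zero _ p
            have h := congrArg (Ideal.Quotient.mk (J p)) this
            rw [map_natCast, map_zero] at h
            rw [← h]
            exact_mod_cast congrArg (Nat.cast : ℕ → P p ⧸ J p) h5.symm
          generalize Ideal.Quotient.mk (J p) (x p) ^ (p - 1) = a at *
          generalize Ideal.Quotient.mk (J p) (y p) ^ (p - 1) = b at *
          rw [geom_sum_eq_of_eq_three h5] at hd
          linear_combination ha + hb + h1 - hd + a * b ^ 2 * h30
      rw [Ideal.span_le]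
      rintro f (rfl | rfl | rfl)
      exacts [hδ, hγ, hμ]

theorem delta_mem_J (p : ℕ) [Fact p.Prime] : delta p ∈ J p :=
  J_eq_span_smallGens p ▸ Ideal.subset_span (by simp [smallGens])

theorem gam_two_mem_J (p : ℕ) [Fact p.Prime] : gam p 2 ∈ J p :=
  J_eq_span_smallGens p ▸ Ideal.subset_span (by simp [smallGens])

theorem top_mem_J (p : ℕ) [Fact p.Prime] : x p ^ (p - 1) * y p ^ (2 * p - 2) ∈ J p :=
  J_eq_span_smallGens p ▸ Ideal.subset_span (by simp [smallGens])

theorem J_eq_span (p : ℕ) [Fact p.Prime] :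
    J p = Ideal.span {d1 p, delta p, gam p 2, x p ^ (p - 1) * y p ^ (2 * p - 2)} := by
  apply le_antisymm
  · rw [J_eq_span_smallGens]
    exact Ideal.span_mono (Set.subset_insert _ _)
  · rw [Ideal.span_le]
    rintro f (rfl | rfl | rfl | rfl)
    exacts [d1_mem_of (delta_mem_J p) (gam_two_mem_J p) (top_mem_J p), delta_mem_J p,
      gam_two_mem_J p, top_mem_J p]

/-! ### Monomials and their normal forms -/

/-- The monomial `x^i y^j`. -/
def mon (p i j : ℕ) : P p := x p ^ i * y p ^ j

theorem mon_mul_mon (p i j k l : ℕ) : mon p i j * mon p k l = mon p (i + k) (j + l) := by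
  simp only [mon]
  ring

theorem monomial_eq_smul_mon {p : ℕ} (s : Fin 2 →₀ ℕ) (c : ZMod p) :
    monomial s c = c • mon p (s 0) (s 1) := by
  rw [monomial_eq, Finsupp.prod_fintype _ _ (by simp), Fin.prod_univ_two, smul_eq_C_mul]
  rfl

theorem mon_eq_monomial (p i j : ℕ) :
    mon p i j = monomial (Finsupp.single 0 i + Finsupp.single 1 j) 1 := by
  rw [monomial_eq_smul_mon]
  simp

theorem delta_eq_mon (p : ℕ) : delta p = mon p 1 p - mon p p 1 := by
  simp [delta, mon]

theorem gam_two_eq_mon (p : ℕ) :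
    gam p 2 = mon p (2 * p - 2) 0 - mon p (p - 1) (p - 1) + mon p 0 (2 * p - 2) := by
  simp [gam, mon, show 2 * (p - 1) = 2 * p - 2 by omega]

theorem mon_mul_delta (p i j : ℕ) :
    mon p i j * delta p = mon p (i + 1) (j + p) - mon p (i + p) (j + 1) := by
  rw [delta_eq_mon, mul_sub, mon_mul_mon, mon_mul_mon]

theorem mon_mul_gam_two (p i j : ℕ) :
    mon p i j * gam p 2 = mon p (i + (2 * p - 2)) j - mon p (i + (p - 1)) (j + (p - 1)) +
      mon p i (j + (2 * p - 2)) := by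
  simp only [gam_two_eq_mon, mul_sub, mul_add, mon_mul_mon, add_zero]

theorem linearMap_ext_mon {p : ℕ} {M : Type*} [AddCommMonoid M] [Module (ZMod p) M]
    {φ ψ : P p →ₗ[ZMod p] M} (h : ∀ i j, φ (mon p i j) = ψ (mon p i j)) : φ = ψ := by
  refine (basisMonomials (Fin 2) (ZMod p)).ext fun s => ?_
  simpa [monomial_eq_smul_mon] using h (s 0) (s 1)

/-- A linear map vanishing on all monomial multiples of the generators vanishes on `J`. -/
theorem map_eq_zero_of_mem_J {p : ℕ} [Fact p.Prime] {M : Type*} [AddCommMonoid M]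
    [Module (ZMod p) M] (φ : P p →ₗ[ZMod p] M) (h1 : ∀ i j, φ (mon p i j * delta p) = 0)
    (h2 : ∀ i j, φ (mon p i j * gam p 2) = 0)
    (h3 : ∀ i j, φ (mon p (i + (p - 1)) (j + (2 * p - 2))) = 0) {f : P p} (hf : f ∈ J p) :
    φ f = 0 := by
  have key : ∀ g : P p, (∀ i j, φ (mon p i j * g) = 0) → ∀ a, φ (a * g) = 0 := by
    intro g hg a
    have : φ ∘ₗ LinearMap.mulRight (ZMod p) g = 0 := linearMap_ext_mon fun i j => by
      simpa using hg i j
    simpa using LinearMap.congr_fun this a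
  rw [J_eq_span_smallGens, smallGens, Ideal.mem_span_insert] at hf
  obtain ⟨a, u, hu, rfl⟩ := hf
  rw [Ideal.mem_span_pair] at hu
  obtain ⟨b, c, rfl⟩ := hu
  rw [map_add, map_add, key _ h1, key _ h2, key (x p ^ (p - 1) * y p ^ (2 * p - 2)), zero_add,
    zero_add]
  intro i j
  rw [← h3 i j, ← mon_mul_mon]
  rfl

/-- The representative of `i` modulo `p - 1` in `{1, …, p - 1}`. -/
def rho (p i : ℕ) : ℕ := (i - 1) % (p - 1) + 1

theorem rho_pos (p i : ℕ) : 1 ≤ rho p i := Nat.le_add_left _ _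

theorem rho_le {p : ℕ} (hp : 2 ≤ p) (i : ℕ) : rho p i ≤ p - 1 :=
  Nat.mod_lt _ (by omega)

theorem rho_le_self (p : ℕ) {i : ℕ} (hi : 1 ≤ i) : rho p i ≤ i := by
  have := Nat.mod_le (i - 1) (p - 1)
  unfold rho
  omega

theorem rho_eq_self {p i : ℕ} (hi : 1 ≤ i) (hip : i ≤ p - 1) : rho p i = i := by
  rw [rho, Nat.mod_eq_of_lt (by omega)]
  omega

theorem rho_add {p i : ℕ} (hi : 1 ≤ i) : rho p (i + (p - 1)) = rho p i := by
  rw [rho, rho, show i + (p - 1) - 1 = i - 1 + (p - 1) by omega, Nat.add_mod_right]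

theorem rho_sub_one {p : ℕ} (hp : 2 ≤ p) : rho p (p - 1) = p - 1 :=
  rho_eq_self (by omega) le_rfl

theorem exists_eq_rho_add (p : ℕ) {i : ℕ} (hi : 1 ≤ i) : ∃ k, i = rho p i + (p - 1) * k :=
  ⟨(i - 1) / (p - 1), by
    have := Nat.mod_add_div (i - 1) (p - 1)
    unfold rho
    omega⟩

/-- The normal form of `x^i y^j` modulo `J`, as a combination of exponents in `Θ`. -/
def nf (p i j : ℕ) : ℕ × ℕ →₀ ZMod p :=
  if j = 0 then
    if i ≤ 2 * p - 3 then Finsupp.single (i, 0) 1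
    else if i = 2 * p - 2 then
      Finsupp.single (p - 1, p - 1) 1 - Finsupp.single (0, 2 * p - 2) 1
    else 0
  else if i = 0 then
    if j ≤ 2 * p - 2 then Finsupp.single (0, j) 1 else 0
  else if i + j - rho p i ≤ 2 * p - 2 ∧ i + j ≠ 3 * p - 3 then
    Finsupp.single (rho p i, i + j - rho p i) 1
  else 0

section nf

variable {p : ℕ}

theorem nf_of_pos {i j : ℕ} (hi : 1 ≤ i) (hj : 1 ≤ j) :
    nf p i j = if i + j - rho p i ≤ 2 * p - 2 ∧ i + j ≠ 3 * p - 3 then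
      Finsupp.single (rho p i, i + j - rho p i) 1 else 0 := by
  rw [nf, if_neg (by omega), if_neg (by omega)]

/-- When both exponents are positive, the normal form depends only on the degree and on `rho`, and
both agree here. -/
theorem nf_delta (hp : 2 ≤ p) (i j : ℕ) : nf p (i + 1) (j + p) = nf p (i + p) (j + 1) := by
  have h : rho p (i + p) = rho p (i + 1) := by
    rw [show i + p = i + 1 + (p - 1) by omega, rho_add (by omega)]
  have e : i + p + (j + 1) = i + 1 + (j + p) := by ring
  rw [nf_of_pos (by omega) (by omega), nf_of_pos (by omega) (by omega), h, e]

/-- For i > 0 the first term is zero and the other two agree by the exponent swap; for i = 0 < j the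
last is zero and the first two agree. The case i = j = 0 is the rule for x^(2p-2) built into `nf`.
-/
theorem nf_gam_two (hp : 2 ≤ p) (i j : ℕ) :
    nf p (i + (2 * p - 2)) j - nf p (i + (p - 1)) (j + (p - 1)) + nf p i (j + (2 * p - 2)) = 0 := by
  rcases Nat.eq_zero_or_pos i with rfl | hi
  · have e2 : nf p (0 + (p - 1)) (j + (p - 1)) =
        if j = 0 then Finsupp.single (p - 1, p - 1) 1 else nf p (2 * p - 2) j := by
      rw [zero_add]
      split_ifs with hj
      · subst hj
        rw [nf_of_pos (by omega) (by omega), rho_sub_one hp, if_pos (by omega)]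
        congr 2
        omega
      · have h : rho p (2 * p - 2) = rho p (p - 1) := by
          rw [show 2 * p - 2 = (p - 1) + (p - 1) by omega, rho_add (by omega)]
        rw [nf_of_pos (by omega) (by omega), nf_of_pos (by omega) (by omega), h,
          show p - 1 + (j + (p - 1)) = 2 * p - 2 + j by omega]
    rw [e2, zero_add]
    rcases Nat.eq_zero_or_pos j with rfl | hj
    · rw [if_pos rfl, nf, if_pos rfl, if_neg (by omega), if_pos rfl, nf, if_neg (by omega),
        if_pos rfl, if_pos (by omega), zero_add]
      abel
    · rw [if_neg (by omega), sub_self, zero_add, nf, if_neg (by omega), if_pos rfl,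
        if_neg (by omega)]
  · have hr1 := rho_le_self p hi
    have hr2 := rho_le hp i
    have h2 : rho p (i + (2 * p - 2)) = rho p i := by
      rw [show i + (2 * p - 2) = i + (p - 1) + (p - 1) by omega, rho_add (by omega), rho_add hi]
    have e1 : nf p (i + (2 * p - 2)) j = 0 := by
      rw [nf]
      split_ifs with h3 h4 h5 h6 h7 <;> first | rfl | omega
    have e2 : nf p (i + (p - 1)) (j + (p - 1)) = nf p i (j + (2 * p - 2)) := by
      rw [nf_of_pos (by omega) (by omega), nf_of_pos (by omega) (by omega), rho_add hi, show i + (p - 1) + (j + (p - 1)) = i + (j + (2 * p - 2)) by omega]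
    rw [e1, e2]
    simp

theorem nf_top (hp : 2 ≤ p) (i j : ℕ) : nf p (i + (p - 1)) (j + (2 * p - 2)) = 0 := by
  have := rho_le hp (i + (p - 1))
  rw [nf, if_neg (by omega), if_neg (by omega), if_neg (by omega)]

theorem nf_of_mem_Theta {i j : ℕ} (h : (i, j) ∈ Theta p) :
    nf p i j = Finsupp.single (i, j) 1 := by
  rw [nf]
  rcases h with ⟨h1, h2, h3⟩ | ⟨h1, h2, h3⟩ <;> simp only at h1 h2 h3
  · rcases Nat.eq_zero_or_pos i with rfl | hi
    · by_cases h4 : j = 0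
      · rw [if_pos h4, if_pos (Nat.zero_le _), h4]
      · rw [if_neg h4, if_pos rfl, if_pos h2]
    · rw [rho_eq_self hi h1]
      split_ifs with h4 h5 h6 h6 h7
      · rw [h4]
      · omega
      · omega
      · omega
      · congr 2
        omega
      · omega
  · rw [if_pos h3, if_pos h2, h3]

theorem mem_Theta_of_nf_ne_zero (hp : 2 ≤ p) {i j : ℕ} {t : ℕ × ℕ} (h : nf p i j t ≠ 0) :
    t ∈ Theta p ∧ t.1 + t.2 = i + j := by
  have hs : ∀ a b : ℕ, (a, b) ∈ Theta p ∧ a + b = i + j →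
      Finsupp.single (a, b) (1 : ZMod p) t ≠ 0 → t ∈ Theta p ∧ t.1 + t.2 = i + j := by
    intro a b hab hne
    have : (a, b) = t := by
      by_contra hc
      exact hne (Finsupp.single_eq_of_ne' hc)
    exact this ▸ hab
  have hr := rho_le hp i
  have hr' := rho_pos p i
  rw [nf] at h
  split_ifs at h with h1 h2 h3 h4 h5 h6
  · refine hs _ _ ⟨?_, by omega⟩ h
    rcases le_or_gt i (p - 1) with hi | hi
    · exact Or.inl ⟨hi, Nat.zero_le _, by simp only; omega⟩
    · exact Or.inr ⟨by simp only; omega, h2, rfl⟩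
  · rw [Finsupp.sub_apply] at h
    by_cases h7 : Finsupp.single (p - 1, p - 1) (1 : ZMod p) t = 0
    · rw [h7, zero_sub, neg_ne_zero] at h
      exact hs 0 (2 * p - 2) ⟨Or.inl ⟨Nat.zero_le _, le_rfl, by simp only; omega⟩, by omega⟩ h
    · exact hs (p - 1) (p - 1) ⟨Or.inl ⟨le_rfl, by simp only; omega, by simp only; omega⟩, by omega⟩ h7
  · exact absurd rfl h
  · exact hs 0 j ⟨Or.inl ⟨Nat.zero_le _, h5, by simp only; omega⟩, by omega⟩ h
  · exact absurd rfl h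
  · have := rho_le_self p (i := i) (by omega)
    exact hs (rho p i) (i + j - rho p i)
      ⟨Or.inl ⟨hr, h6.1, by simp only; omega⟩, by omega⟩ h
  · exact absurd rfl h

end nf

/-- The normal form modulo `J` as a linear map. -/
def normalForm (p : ℕ) : P p →ₗ[ZMod p] ℕ × ℕ →₀ ZMod p :=
  (basisMonomials (Fin 2) (ZMod p)).constr (ZMod p) fun s => nf p (s 0) (s 1)

theorem normalForm_mon (p i j : ℕ) : normalForm p (mon p i j) = nf p i j := by
  have h := (basisMonomials (Fin 2) (ZMod p)).constr_basis (ZMod p)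
    (fun s => nf p (s 0) (s 1)) (Finsupp.single 0 i + Finsupp.single 1 j)
  rw [coe_basisMonomials] at h
  rw [mon_eq_monomial, normalForm, h]
  simp

theorem normalForm_eq_zero_of_mem_J {p : ℕ} [hp : Fact p.Prime] {f : P p} (hf : f ∈ J p) :
    normalForm p f = 0 := by
  have hp2 := hp.out.two_le
  refine map_eq_zero_of_mem_J _ (fun i j => ?_) (fun i j => ?_) (fun i j => ?_) hf
  · rw [mon_mul_delta, map_sub, normalForm_mon, normalForm_mon, nf_delta hp2, sub_self]
  · simp only [mon_mul_gam_two, map_add, map_sub, normalForm_mon, nf_gam_two hp2]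
  · rw [normalForm_mon, nf_top hp2]

/-- The polynomial with given coefficients. -/
def ofCoeffs (p : ℕ) : (ℕ × ℕ →₀ ZMod p) →ₗ[ZMod p] P p :=
  Finsupp.linearCombination (ZMod p) fun t => mon p t.1 t.2

theorem ofCoeffs_single (p i j : ℕ) : ofCoeffs p (Finsupp.single (i, j) 1) = mon p i j := by
  simp [ofCoeffs]

/-! ### Reduction modulo J and the monomial basis -/

section Reduction

variable {p : ℕ} [hp : Fact p.Prime]

local notation "π" => Ideal.Quotient.mk (J p)

theorem mk_mon_swap {i j : ℕ} (hi : 1 ≤ i) (hj : 1 ≤ j) :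
    π (mon p i (j + (p - 1))) = π (mon p (i + (p - 1)) j) := by
  obtain ⟨i, rfl⟩ := Nat.exists_eq_add_of_le' hi
  obtain ⟨j, rfl⟩ := Nat.exists_eq_add_of_le' hj
  have hp2 := hp.out.two_le
  have h := (J p).mul_mem_left (mon p i j) (delta_mem_J p)
  rw [mon_mul_delta] at h
  rw [Ideal.Quotient.eq, show j + 1 + (p - 1) = j + p by omega,
    show i + 1 + (p - 1) = i + p by omega]
  exact h

theorem mk_mon_gam_two (i j : ℕ) :
    π (mon p (i + (2 * p - 2)) j) - π (mon p (i + (p - 1)) (j + (p - 1))) +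
      π (mon p i (j + (2 * p - 2))) = 0 := by
  have h := (J p).mul_mem_left (mon p i j) (gam_two_mem_J p)
  rw [mon_mul_gam_two] at h
  rw [← map_sub, ← map_add]
  exact Ideal.Quotient.eq_zero_iff_mem.2 h

theorem mk_mon_eq_zero_of_le {i j k l : ℕ} (h : π (mon p i j) = 0) (hi : i ≤ k) (hj : j ≤ l) :
    π (mon p k l) = 0 := by
  rw [← Nat.sub_add_cancel hi, ← Nat.sub_add_cancel hj, ← mon_mul_mon, map_mul, h, mul_zero]

/-- In x γ₂ the last two terms cancel modulo δ, leaving x^(2p-1). -/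
theorem mk_mon_eq_zero_left {i : ℕ} (hi : 2 * p - 1 ≤ i) (j : ℕ) : π (mon p i j) = 0 := by
  have hp2 := hp.out.two_le
  refine mk_mon_eq_zero_of_le (i := 1 + (2 * p - 2)) (j := 0) ?_ (by omega) (Nat.zero_le _)
  have h := mk_mon_gam_two (p := p) 1 0
  have h2 := mk_mon_swap (p := p) (i := 1) (j := p - 1) le_rfl (by omega)
  rw [zero_add, zero_add, show 2 * p - 2 = p - 1 + (p - 1) by omega, h2] at h
  rw [show 2 * p - 2 = p - 1 + (p - 1) by omega]
  linear_combination h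

theorem mk_mon_eq_zero_right (i : ℕ) {j : ℕ} (hj : 2 * p - 1 ≤ j) : π (mon p i j) = 0 := by
  have hp2 := hp.out.two_le
  refine mk_mon_eq_zero_of_le (i := 0) (j := 1 + (2 * p - 2)) ?_ (Nat.zero_le _) (by omega)
  have h := mk_mon_gam_two (p := p) 0 1
  have h2 := mk_mon_swap (p := p) (i := p - 1) (j := 1) (by omega) le_rfl
  rw [zero_add, zero_add, show 2 * p - 2 = p - 1 + (p - 1) by omega, h2] at h
  rw [show 2 * p - 2 = p - 1 + (p - 1) by omega]
  linear_combination h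

theorem mk_mon_swap_mul {i j : ℕ} (hi : 1 ≤ i) (hj : 1 ≤ j) (k : ℕ) :
    π (mon p i (j + (p - 1) * k)) = π (mon p (i + (p - 1) * k) j) := by
  induction k generalizing i with
  | zero => rfl
  | succ k ih =>
    rw [Nat.mul_succ, ← add_assoc, mk_mon_swap hi (by omega), ih (by omega)]
    congr 2
    ring

theorem mk_mon_eq_rho {i j : ℕ} (hi : 1 ≤ i) (hj : 1 ≤ j) :
    π (mon p i j) = π (mon p (rho p i) (i + j - rho p i)) := by
  obtain ⟨k, hk⟩ := exists_eq_rho_add p hi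
  have h := mk_mon_swap_mul (p := p) (rho_pos p i) hj k
  rw [← hk] at h
  rw [← h]
  congr 2
  omega

theorem mk_ofCoeffs_nf (i j : ℕ) : π (ofCoeffs p (nf p i j)) = π (mon p i j) := by
  have hp2 := hp.out.two_le
  rw [nf]
  split_ifs with h1 h2 h3 h4 h5 h6
  · rw [ofCoeffs_single, h1]
  · have h := mk_mon_gam_two (p := p) 0 0
    simp only [zero_add] at h
    rw [map_sub, ofCoeffs_single, ofCoeffs_single, h1, h3, map_sub]
    linear_combination -h
  · rw [map_zero, map_zero, mk_mon_eq_zero_left (by omega)]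
  · rw [ofCoeffs_single, h4]
  · rw [map_zero, map_zero, mk_mon_eq_zero_right _ (by omega)]
  · rw [ofCoeffs_single, mk_mon_eq_rho (i := i) (by omega) (by omega)]
  · rw [map_zero, map_zero, mk_mon_eq_rho (by omega) (by omega)]
    have hr := rho_le hp2 i
    have hr2 := rho_le_self p (i := i) (by omega)
    -- If the y-exponent is at most 2p - 2, the degree is 3p - 3, and the bound on `rho` leaves only
    -- the corner x^(p-1) y^(2p-2).
    rcases le_or_gt (i + j - rho p i) (2 * p - 2) with h | h
    · rw [show rho p i = p - 1 by omega, show i + j - (p - 1) = 2 * p - 2 by omega]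
      exact (Ideal.Quotient.eq_zero_iff_mem.2 (top_mem_J p)).symm
    · rw [mk_mon_eq_zero_right _ (by omega)]

theorem mk_ofCoeffs_normalForm (f : P p) : π (ofCoeffs p (normalForm p f)) = π f := by
  have : (Ideal.Quotient.mkₐ (ZMod p) (J p)).toLinearMap ∘ₗ ofCoeffs p ∘ₗ normalForm p =
      (Ideal.Quotient.mkₐ (ZMod p) (J p)).toLinearMap := linearMap_ext_mon fun i j => by
    simpa [normalForm_mon] using mk_ofCoeffs_nf i j
  simpa using LinearMap.congr_fun this f

theorem mem_J_iff_normalForm_eq_zero {f : P p} : f ∈ J p ↔ normalForm p f = 0 := by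
  refine ⟨normalForm_eq_zero_of_mem_J, fun h => ?_⟩
  rw [← Ideal.Quotient.eq_zero_iff_mem, ← mk_ofCoeffs_normalForm, h, map_zero, map_zero]

theorem normalForm_mem_Theta (f : P p) {t : ℕ × ℕ} (ht : normalForm p f t ≠ 0) :
    ∃ s ∈ f.support, t ∈ Theta p ∧ t.1 + t.2 = s 0 + s 1 := by
  by_contra! hc
  refine ht ?_
  rw [f.as_sum, map_sum, Finsupp.finsetSum_apply]
  refine Finset.sum_eq_zero fun s hs => ?_
  rw [monomial_eq_smul_mon, map_smul, normalForm_mon, Finsupp.smul_apply]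
  by_contra h
  have h := mem_Theta_of_nf_ne_zero hp.out.two_le (right_ne_zero_of_mul h)
  exact hc s hs h.1 h.2

variable (p) in
theorem linearIndependent_Theta :
    LinearIndependent (ZMod p) fun t : Theta p => π (mon p t.1.1 t.1.2) := by
  rw [linearIndependent_iff]
  intro c hc
  have h1 : Finsupp.linearCombination (ZMod p) (fun t : Theta p => mon p t.1.1 t.1.2) c ∈ J p := by
    rw [← Ideal.Quotient.eq_zero_iff_mem, ← hc]
    have := (Finsupp.apply_linearCombination (ZMod p)
      (Ideal.Quotient.mkₐ (ZMod p) (J p)).toLinearMap (fun t : Theta p => mon p t.1.1 t.1.2) c)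
    simpa [Function.comp_def] using this
  have h2 := normalForm_eq_zero_of_mem_J h1
  rw [Finsupp.apply_linearCombination] at h2
  have h3 : (normalForm p ∘ fun t : Theta p => mon p t.1.1 t.1.2) =
      fun t : Theta p => Finsupp.single (t : ℕ × ℕ) (1 : ZMod p) := by
    funext t
    rw [Function.comp_apply, normalForm_mon, nf_of_mem_Theta t.2]
  rw [h3] at h2
  have h4 : LinearIndependent (ZMod p)
      fun t : Theta p => Finsupp.single (t : ℕ × ℕ) (1 : ZMod p) :=
    (Finsupp.linearIndependent_single_one (ZMod p) (ℕ × ℕ)).comp _ Subtype.val_injective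
  exact linearIndependent_iff.1 h4 c h2

variable (p) in
theorem span_Theta :
    ⊤ ≤ Submodule.span (ZMod p) (Set.range fun t : Theta p => π (mon p t.1.1 t.1.2)) := by
  rintro q -
  obtain ⟨f, rfl⟩ := Ideal.Quotient.mk_surjective q
  rw [← mk_ofCoeffs_normalForm, ofCoeffs]
  have := Finsupp.apply_linearCombination (ZMod p)
      (Ideal.Quotient.mkₐ (ZMod p) (J p)).toLinearMap (fun t : ℕ × ℕ => mon p t.1 t.2)
      (normalForm p f)
  change π _ = _ at this
  rw [this, Finsupp.linearCombination_apply]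
  refine Submodule.sum_mem _ fun t ht => Submodule.smul_mem _ _ (Submodule.subset_span ?_)
  obtain ⟨s, -, h, -⟩ := normalForm_mem_Theta f (Finsupp.mem_support_iff.1 ht)
  exact ⟨⟨t, h⟩, rfl⟩

variable (p) in
theorem exists_basis_Theta : ∃ b : Module.Basis (Theta p) (ZMod p) (Q p),
    ∀ t : Theta p, b t = π (x p ^ t.1.1 * y p ^ t.1.2) :=
  ⟨Module.Basis.mk (linearIndependent_Theta p) (span_Theta p), fun t => Module.Basis.mk_apply _ _ t⟩

end Reduction

/-! ### Homogeneity and sums over the points of 𝔽_p² -/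

theorem isHomogeneous_mon (p i j : ℕ) : (mon p i j).IsHomogeneous (i + j) :=
  (isHomogeneous_X_pow _ _).mul (isHomogeneous_X_pow _ _)

theorem isHomogeneous_mon_of_eq {p i j n : ℕ} (h : i + j = n) : (mon p i j).IsHomogeneous n :=
  h ▸ isHomogeneous_mon p i j

theorem isHomogeneous_delta (p : ℕ) : (delta p).IsHomogeneous (p + 1) :=
  delta_eq_mon p ▸
    (isHomogeneous_mon_of_eq (add_comm 1 p)).sub (isHomogeneous_mon_of_eq rfl)

theorem isHomogeneous_gam_two (p : ℕ) : (gam p 2).IsHomogeneous (2 * p - 2) := by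
  rw [gam_two_eq_mon]
  exact ((isHomogeneous_mon_of_eq (by omega)).sub (isHomogeneous_mon_of_eq (by omega))).add
    (isHomogeneous_mon_of_eq (by omega))

theorem eval_zero_of_isHomogeneous {p n : ℕ} {f : P p} (hf : f.IsHomogeneous n) (hn : n ≠ 0) :
    eval 0 f = 0 := by
  rw [eval_zero]
  exact hf.coeff_eq_zero (by simpa using hn.symm)

section Sums

variable {p : ℕ} [hp : Fact p.Prime]

theorem eval_mon (v : Fin 2 → ZMod p) (i j : ℕ) : eval v (mon p i j) = v 0 ^ i * v 1 ^ j := by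
  simp [mon]

theorem eval_delta (v : Fin 2 → ZMod p) : eval v (delta p) = 0 := by
  simp [delta, ZMod.pow_card]

theorem pow_card_sub_one_eq_ite (a : ZMod p) : a ^ (p - 1) = if a = 0 then 0 else 1 := by
  split_ifs with h
  · rw [h, zero_pow (by have := hp.out.two_le; omega)]
  · exact ZMod.pow_card_sub_one_eq_one h

/-- Each (p-1)-st power is 0 or 1, so the value is 1 - 0 + 0, 0 - 0 + 1 or 1 - 1 + 1. -/
theorem eval_gam_two {v : Fin 2 → ZMod p} (hv : v ≠ 0) : eval v (gam p 2) = 1 := by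
  simp only [gam, map_add, map_sub, map_mul, map_pow, eval_X, show 2 - 1 = 1 from rfl, one_mul,
    mul_comm 2 (p - 1), pow_mul, pow_card_sub_one_eq_ite]
  have : v 0 ≠ 0 ∨ v 1 ≠ 0 := by
    by_contra! h
    exact hv (funext fun i => by fin_cases i <;> simp [h])
  rcases this with h | h <;> by_cases h' : v 0 = 0 <;> by_cases h'' : v 1 = 0 <;> simp_all

/-- The power sum `∑ a^n` over `𝔽_p`. -/
def powerSum (p n : ℕ) [Fact p.Prime] : ZMod p := ∑ a : ZMod p, a ^ n

theorem powerSum_eq_zero {n : ℕ} (hn : n < 2 * p - 2) (hn' : n ≠ p - 1) : powerSum p n = 0 := by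
  rcases lt_or_ge n (p - 1) with h | h
  · exact FiniteField.sum_pow_lt_card_sub_one (ZMod p) n (by rwa [ZMod.card])
  · have : powerSum p n = powerSum p (n - (p - 1)) := by
      refine Finset.sum_congr rfl fun a _ => ?_
      nth_rw 1 [← Nat.sub_add_cancel h]
      rw [pow_add, pow_card_sub_one_eq_ite]
      split_ifs with ha
      · rw [mul_zero, ha, zero_pow (by omega)]
      · rw [mul_one]
    rw [this]
    exact FiniteField.sum_pow_lt_card_sub_one (ZMod p) _ (by rw [ZMod.card]; omega)

theorem powerSum_sub_one : powerSum p (p - 1) = -1 := by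
  simp [powerSum, pow_card_sub_one_eq_ite, Finset.sum_ite, Finset.filter_ne',
    hp.out.one_le]

theorem powerSum_two_mul_sub : powerSum p (2 * p - 2) = -1 := by
  rw [← powerSum_sub_one]
  refine Finset.sum_congr rfl fun a _ => ?_
  rw [show 2 * p - 2 = (p - 1) * 2 by omega, pow_mul, pow_card_sub_one_eq_ite]
  split_ifs <;> simp

variable (p) in
/-- The sum of the values of a polynomial over `𝔽_p²`. -/
def pointSum : P p →ₗ[ZMod p] ZMod p :=
  ∑ v : Fin 2 → ZMod p, (aeval v : P p →ₐ[ZMod p] ZMod p).toLinearMap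

theorem pointSum_apply (f : P p) : pointSum p f = ∑ v : Fin 2 → ZMod p, eval v f := by
  simp [pointSum, LinearMap.sum_apply, aeval_eq_eval]

theorem pointSum_mon (i j : ℕ) : pointSum p (mon p i j) = powerSum p i * powerSum p j := by
  have h := Finset.prod_univ_sum (fun _ : Fin 2 => (Finset.univ : Finset (ZMod p)))
    (fun k a => a ^ (![i, j] k))
  rw [Fin.prod_univ_two, Fintype.piFinset_univ] at h
  simp only [Fin.prod_univ_two] at h
  simp only [pointSum_apply, eval_mon]
  exact h.symm

theorem pointSum_eq_zero {f : P p} {n : ℕ} (hf : f.IsHomogeneous n) (hn : n < 2 * p - 2) :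
    pointSum p f = 0 := by
  rw [pointSum_apply]
  refine MvPolynomial.sum_eval_eq_zero f (lt_of_le_of_lt hf.totalDegree_le ?_)
  rw [ZMod.card, Fintype.card_fin]
  omega

theorem pointSum_eq_zero_of_eval {f : P p} (hf : ∀ v, eval v f = 0) : pointSum p f = 0 := by
  rw [pointSum_apply, Finset.sum_eq_zero fun v _ => hf v]

/-- In degree `d < 2p - 2`, elements of `J` vanish at all points of `𝔽_p²`. -/
theorem eval_homogeneousComponent_of_mem_J {d : ℕ} (hd : d < 2 * p - 2) {q : P p} (hq : q ∈ J p)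
    (v : Fin 2 → ZMod p) : eval v (homogeneousComponent d q) = 0 := by
  have := map_eq_zero_of_mem_J
    ((aeval v : P p →ₐ[ZMod p] ZMod p).toLinearMap ∘ₗ homogeneousComponent d)
    (fun i j => ?_) (fun i j => ?_) (fun i j => ?_) hq
  · simpa [aeval_eq_eval] using this
  · rw [LinearMap.comp_apply, homogeneousComponent_of_mem
      ((isHomogeneous_mon p i j).mul (isHomogeneous_delta p))]
    split_ifs
    · simp [aeval_eq_eval, eval_delta]
    · exact map_zero _
  · rw [LinearMap.comp_apply, homogeneousComponent_of_mem
      ((isHomogeneous_mon p i j).mul (isHomogeneous_gam_two p)), if_neg (by omega), map_zero]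
  · rw [LinearMap.comp_apply, homogeneousComponent_of_mem (isHomogeneous_mon p _ _),
      if_neg (by have := hp.out.two_le; omega), map_zero]

/-- Multiplication by γ₂ changes no value off the origin, and f vanishes at the origin. -/
theorem pointSum_gam_two_mul {f : P p} {n : ℕ} (hf : f.IsHomogeneous n) (hn0 : n ≠ 0)
    (hn : n < 2 * p - 2) : pointSum p (gam p 2 * f) = 0 := by
  rw [← pointSum_eq_zero hf hn, pointSum_apply, pointSum_apply]
  refine Finset.sum_congr rfl fun v _ => ?_
  by_cases hv : v = 0
  · rw [hv, map_mul, eval_zero_of_isHomogeneous hf hn0, mul_zero]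
  · rw [map_mul, eval_gam_two hv, one_mul]

/-- The pairing `(f, h) ↦ ∑ f(v) h(v)` in complementary degrees vanishes on `J`. -/
theorem pointSum_homogeneousComponent_mul_of_mem_J {d m : ℕ} (hm : 1 ≤ m)
    (hdm : d + m = 3 * p - 3) {h : P p} (hh : h.IsHomogeneous m) {q : P p} (hq : q ∈ J p) :
    pointSum p (homogeneousComponent d q * h) = 0 := by
  have hp2 := hp.out.two_le
  refine map_eq_zero_of_mem_J
    (pointSum p ∘ₗ LinearMap.mulRight (ZMod p) h ∘ₗ homogeneousComponent d)
    (fun i j => ?_) (fun i j => ?_) (fun i j => ?_) hq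
  · rw [LinearMap.comp_apply, LinearMap.comp_apply, homogeneousComponent_of_mem
      ((isHomogeneous_mon p i j).mul (isHomogeneous_delta p))]
    split_ifs
    · exact pointSum_eq_zero_of_eval fun v => by simp [eval_delta]
    · simp
  · rw [LinearMap.comp_apply, LinearMap.comp_apply, homogeneousComponent_of_mem
      ((isHomogeneous_mon p i j).mul (isHomogeneous_gam_two p))]
    split_ifs with hij
    · rw [LinearMap.mulRight_apply, mul_comm (mon p i j), mul_assoc]
      exact pointSum_gam_two_mul ((isHomogeneous_mon p i j).mul hh) (by omega) (by omega)
    · simp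
  -- These monomials have degree at least 3p - 3, which exceeds d since m ≥ 1.
  · rw [LinearMap.comp_apply, LinearMap.comp_apply,
      homogeneousComponent_of_mem (isHomogeneous_mon p _ _), if_neg (by omega), map_zero,
      map_zero]

theorem map_eq_sum_normalForm {φ : P p →ₗ[ZMod p] ZMod p} (hφ : ∀ q ∈ J p, φ q = 0) (f : P p) :
    φ f = ∑ t ∈ (normalForm p f).support, normalForm p f t * φ (mon p t.1 t.2) := by
  have h := hφ _ (Ideal.Quotient.eq.1 (mk_ofCoeffs_normalForm f))
  rw [map_sub, sub_eq_zero] at h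
  rw [← h, ofCoeffs, Finsupp.apply_linearCombination, Finsupp.linearCombination_apply]
  rfl

theorem normalForm_mem_Theta_of_isHomogeneous {f : P p} {d : ℕ} (hf : f.IsHomogeneous d)
    {t : ℕ × ℕ} (ht : normalForm p f t ≠ 0) : t ∈ Theta p ∧ t.1 + t.2 = d := by
  obtain ⟨s, hs, h1, h2⟩ := normalForm_mem_Theta f ht
  refine ⟨h1, h2.trans ?_⟩
  have := hf.degree_eq_sum_deg_support hs
  rw [this, ← Finsupp.degree_apply, Finsupp.degree_eq_sum, Fin.sum_univ_two]

/-- The exponent bounds in Θ allow degree 3p - 3 only at the corner (p - 1, 2p - 2), which Θ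
excludes. -/
theorem mem_J_of_isHomogeneous_of_le {f : P p} {d : ℕ} (hf : f.IsHomogeneous d)
    (hd : 3 * p - 3 ≤ d) : f ∈ J p := by
  have hp2 := hp.out.two_le
  rw [mem_J_iff_normalForm_eq_zero]
  ext t
  by_contra ht
  obtain ⟨h | h, h'⟩ := normalForm_mem_Theta_of_isHomogeneous hf ht
  · have := h.1; have := h.2.1; have := h.2.2
    omega
  · have := h.1; have := h.2.1; have := h.2.2
    omega

/-- The pairing by point sums is nondegenerate on `Q` in degrees `2p - 2 ≤ d < 3p - 3`. -/
theorem mem_J_of_pointSum_mul_eq_zero {f : P p} {d m : ℕ} (hf : f.IsHomogeneous d)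
    (hd : 2 * p - 2 ≤ d) (hm : 1 ≤ m) (hdm : d + m = 3 * p - 3)
    (h : ∀ k ≤ m, pointSum p (f * mon p k (m - k)) = 0) : f ∈ J p := by
  have hp2 := hp.out.two_le
  have hsupp : ∀ t, normalForm p f t ≠ 0 →
      t.1 ≤ p - 1 ∧ t.2 ≤ 2 * p - 2 ∧ t.1 + t.2 = d := by
    intro t ht
    obtain ⟨h | h, h'⟩ := normalForm_mem_Theta_of_isHomogeneous hf ht
    · exact ⟨h.1, h.2.1, h'⟩
    · have := h.1; have := h.2.1; have := h.2.2
      omega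
  have hsum : ∀ k ≤ m, ∑ t ∈ (normalForm p f).support, normalForm p f t *
      (powerSum p (t.1 + k) * powerSum p (t.2 + (m - k))) = 0 := by
    intro k hk
    have h1 := map_eq_sum_normalForm (φ := pointSum p ∘ₗ
      LinearMap.mulRight (ZMod p) (mon p k (m - k)) ∘ₗ homogeneousComponent d)
      (fun q hq => pointSum_homogeneousComponent_mul_of_mem_J hm hdm
        (isHomogeneous_mon_of_eq (by omega)) hq) f
    simp only [LinearMap.comp_apply, LinearMap.mulRight_apply,
      homogeneousComponent_eq_self hf, h k hk] at h1
    rw [h1]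
    refine Finset.sum_congr rfl fun t ht => ?_
    rw [homogeneousComponent_eq_self (isHomogeneous_mon_of_eq
      (hsupp t (Finsupp.mem_support_iff.1 ht)).2.2), mon_mul_mon, pointSum_mon]
  have hpos : ∀ t, t.1 ≠ 0 → normalForm p f t = 0 := by
    intro t ht0
    by_contra ht
    obtain ⟨h1, h2, h3⟩ := hsupp t ht
    -- This test monomial moves t to (p - 1, 2p - 2), where the power sums multiply to 1. As t.1 ≠
    -- 0, any other s gets an x-exponent below 2p - 2 and different from p - 1, hence contributes 0.
    have h4 := hsum (p - 1 - t.1) (by omega)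
    rw [Finset.sum_eq_single_of_mem t (Finsupp.mem_support_iff.2 ht)] at h4
    · rw [show t.1 + (p - 1 - t.1) = p - 1 by omega,
        show t.2 + (m - (p - 1 - t.1)) = 2 * p - 2 by omega, powerSum_sub_one,
        powerSum_two_mul_sub] at h4
      exact ht (by simpa using h4)
    · intro s hs hst
      obtain ⟨h5, h6, h7⟩ := hsupp s (Finsupp.mem_support_iff.1 hs)
      have : s.1 ≠ t.1 := fun he => hst (Prod.ext he (by omega))
      rw [powerSum_eq_zero (n := s.1 + (p - 1 - t.1)) (by omega) (by omega), zero_mul, mul_zero]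
  rw [mem_J_iff_normalForm_eq_zero]
  ext t
  by_contra ht
  obtain ⟨h1, h2, h3⟩ := hsupp t ht
  have h0 : t.1 = 0 := by
    by_contra h0
    exact ht (hpos t h0)
  -- Only t = (0, d) remains, which forces d = 2p - 2 and m = p - 1.
  have h4 := hsum (p - 1) (by omega)
  rw [Finset.sum_eq_single_of_mem t (Finsupp.mem_support_iff.2 ht)] at h4
  · rw [h0, zero_add, show t.2 + (m - (p - 1)) = 2 * p - 2 by omega, powerSum_sub_one,
      powerSum_two_mul_sub] at h4
    exact ht (by simpa using h4)
  · intro s hs hst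
    obtain ⟨h5, h6, h7⟩ := hsupp s (Finsupp.mem_support_iff.1 hs)
    have : s.1 ≠ t.1 := fun he => hst (Prod.ext he (by omega))
    rw [hpos s (by omega), zero_mul]

/-- The normal form also vanishes at all points. The points (1, 0) and (0, 1) remove its pure
powers; weighted point sums then isolate each remaining coefficient. -/
theorem mem_J_of_forall_eval_eq_zero {f : P p} {d : ℕ} (hf : f.IsHomogeneous d)
    (hd : d < 2 * p - 2) (h : ∀ v, eval v f = 0) : f ∈ J p := by
  have hp2 := hp.out.two_le
  have hsupp : ∀ t, normalForm p f t ≠ 0 → t.1 + t.2 = d ∧ (t.1 ≤ p - 1 ∨ t.2 = 0) := by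
    intro t ht
    obtain ⟨h | h, h'⟩ := normalForm_mem_Theta_of_isHomogeneous hf ht
    · exact ⟨h', Or.inl h.1⟩
    · exact ⟨h', Or.inr h.2.2⟩
  have heval : ∀ v : Fin 2 → ZMod p, ∑ t ∈ (normalForm p f).support, normalForm p f t *
      (v 0 ^ t.1 * v 1 ^ t.2) = 0 := by
    intro v
    have h1 := map_eq_sum_normalForm
      (φ := (aeval v : P p →ₐ[ZMod p] ZMod p).toLinearMap ∘ₗ homogeneousComponent d)
      (fun q hq => by
        simpa [aeval_eq_eval] using eval_homogeneousComponent_of_mem_J hd hq v) f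
    simp only [LinearMap.comp_apply, homogeneousComponent_eq_self hf, AlgHom.toLinearMap_apply,
      aeval_eq_eval, h v] at h1
    rw [h1]
    refine Finset.sum_congr rfl fun t ht => ?_
    rw [homogeneousComponent_eq_self (isHomogeneous_mon_of_eq
      (hsupp t (Finsupp.mem_support_iff.1 ht)).1), eval_mon]
  have hx : ∀ t, t.2 = 0 → normalForm p f t = 0 := by
    intro t ht0
    by_contra ht
    have h1 := heval ![1, 0]
    rw [Finset.sum_eq_single_of_mem t (Finsupp.mem_support_iff.2 ht)] at h1
    · exact ht (by simpa [ht0] using h1)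
    · intro s hs hst
      have := (hsupp s (Finsupp.mem_support_iff.1 hs)).1
      have := (hsupp t ht).1
      have : s.2 ≠ 0 := fun he => hst (Prod.ext (by omega) (by omega))
      simp [this]
  have hy : ∀ t, t.1 = 0 → normalForm p f t = 0 := by
    intro t ht0
    by_contra ht
    have h1 := heval ![0, 1]
    rw [Finset.sum_eq_single_of_mem t (Finsupp.mem_support_iff.2 ht)] at h1
    · exact ht (by simpa [ht0] using h1)
    · intro s hs hst
      have := (hsupp s (Finsupp.mem_support_iff.1 hs)).1
      have := (hsupp t ht).1
      have : s.1 ≠ 0 := fun he => hst (Prod.ext (by omega) (by omega))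
      simp [this]
  rw [mem_J_iff_normalForm_eq_zero]
  ext t
  by_contra ht
  have ht1 : t.1 ≠ 0 := fun h0 => ht (hy t h0)
  have ht2 : t.2 ≠ 0 := fun h0 => ht (hx t h0)
  obtain ⟨h1, h2⟩ := hsupp t ht
  have h3 : ∑ s ∈ (normalForm p f).support, normalForm p f s *
      (powerSum p (s.1 + (p - 1 - t.1)) * powerSum p (s.2 + (2 * p - 2 - t.2))) = 0 := by
    simp only [← pointSum_mon, pointSum_apply, eval_mon, Finset.mul_sum]
    rw [Finset.sum_comm]
    refine Finset.sum_eq_zero fun v _ => ?_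
    rw [← zero_mul (v 0 ^ (p - 1 - t.1) * v 1 ^ (2 * p - 2 - t.2)), ← heval v, Finset.sum_mul]
    exact Finset.sum_congr rfl fun s _ => by ring
  rw [Finset.sum_eq_single_of_mem t (Finsupp.mem_support_iff.2 ht)] at h3
  · rw [show t.1 + (p - 1 - t.1) = p - 1 by omega,
      show t.2 + (2 * p - 2 - t.2) = 2 * p - 2 by omega, powerSum_sub_one,
      powerSum_two_mul_sub] at h3
    exact ht (by simpa using h3)
  · intro s hs hst
    have hs := Finsupp.mem_support_iff.1 hs
    obtain ⟨h5, h6⟩ := hsupp s hs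
    have : s.2 ≠ 0 := fun h0 => hs (hx s h0)
    have : s.1 ≠ t.1 := fun he => hst (Prod.ext he (by omega))
    rw [powerSum_eq_zero (n := s.1 + (p - 1 - t.1)) (by omega) (by omega), zero_mul, mul_zero]

end Sums

/-! ### The action of SL₂ and stability of J -/

open Matrix in
theorem eval_act {p : ℕ} (g : SpecialLinearGroup (Fin 2) (ZMod p)) (v : Fin 2 → ZMod p)
    (f : P p) : eval v (act p g f) = eval (v ᵥ* g.1) f := by
  have : (aeval v : P p →ₐ[ZMod p] ZMod p).comp (act p g) = aeval (v ᵥ* g.1) := by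
    ext j
    simp [act, vecMul, dotProduct, mul_comm]
  simpa [aeval_eq_eval] using DFunLike.congr_fun this f

open Matrix in
theorem vecMul_coe_inv {p : ℕ} (g : SpecialLinearGroup (Fin 2) (ZMod p)) (v : Fin 2 → ZMod p) :
    (v ᵥ* (g⁻¹).1) ᵥ* g.1 = v := by
  have h : (g⁻¹).1 * g.1 = 1 := congrArg Subtype.val (inv_mul_cancel g)
  rw [vecMul_vecMul, h, vecMul_one]

section Action

variable {p : ℕ} (g : Matrix.SpecialLinearGroup (Fin 2) (ZMod p))

theorem act_x : act p g (x p) = C (g.1 0 0) * x p + C (g.1 1 0) * y p := by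
  simp [act, Fin.sum_univ_two]

theorem act_y : act p g (y p) = C (g.1 0 1) * x p + C (g.1 1 1) * y p := by
  simp [act, Fin.sum_univ_two]

theorem isHomogeneous_act {f : P p} {d : ℕ} (hf : f.IsHomogeneous d) :
    (act p g f).IsHomogeneous d := by
  have := hf.aeval (fun j => ∑ i, C (g.1 i j) * X i) (n := 1) fun j =>
    IsHomogeneous.sum _ _ _ fun i _ => isHomogeneous_C_mul_X _ _
  rwa [one_mul] at this

theorem homogeneousComponent_act (d : ℕ) (f : P p) :
    homogeneousComponent d (act p g f) = act p g (homogeneousComponent d f) := by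
  have : homogeneousComponent d ∘ₗ (act p g).toLinearMap =
      (act p g).toLinearMap ∘ₗ homogeneousComponent d := linearMap_ext_mon fun i j => by
    have h := isHomogeneous_mon p i j
    simp only [LinearMap.comp_apply, AlgHom.toLinearMap_apply]
    rw [homogeneousComponent_of_mem h, homogeneousComponent_of_mem (isHomogeneous_act g h)]
    split_ifs
    · rfl
    · rw [map_zero]
  exact LinearMap.congr_fun this f

variable [hp : Fact p.Prime]

theorem act_delta : act p g (delta p) = delta p := by
  have hdet : (C (g.1 0 0) * C (g.1 1 1) - C (g.1 0 1) * C (g.1 1 0) : P p) = 1 := by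
    rw [← C_mul, ← C_mul, ← C_sub, ← Matrix.det_fin_two, g.2, C_1]
  have hpow : ∀ a b : ZMod p, (C a * x p + C b * y p) ^ p = C a * x p ^ p + C b * y p ^ p := by
    intro a b
    rw [add_pow_char, mul_pow, mul_pow, ← C_pow, ← C_pow, ZMod.pow_card, ZMod.pow_card]
  rw [delta, map_sub, map_mul, map_mul, map_pow, map_pow, act_x, act_y, hpow, hpow]
  linear_combination (x p * y p ^ p - x p ^ p * y p) * hdet

/-- The translate of γ₂ still equals 1 at every nonzero vector, so its pairing with a form of degree
p - 1 is the point sum of that form, which is 0. -/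
theorem act_gam_two_mem_J : act p g (gam p 2) ∈ J p := by
  have hp2 := hp.out.two_le
  refine mem_J_of_pointSum_mul_eq_zero (isHomogeneous_act g (isHomogeneous_gam_two p)) le_rfl
    (m := p - 1) (by omega) (by omega) fun k hk => ?_
  have hh : (mon p k (p - 1 - k)).IsHomogeneous (p - 1) := isHomogeneous_mon_of_eq (by omega)
  rw [← pointSum_eq_zero hh (by omega), pointSum_apply, pointSum_apply]
  refine Finset.sum_congr rfl fun v _ => ?_
  by_cases hv : v = 0
  · rw [hv, map_mul, eval_zero_of_isHomogeneous hh (by omega), mul_zero]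
  · rw [map_mul, eval_act, eval_gam_two, one_mul]
    intro h
    have := congrArg (Matrix.vecMul · (g⁻¹).1) h
    simp only [Matrix.vecMul_vecMul, Matrix.zero_vecMul, ← Matrix.SpecialLinearGroup.coe_mul,
      mul_inv_cancel, Matrix.SpecialLinearGroup.coe_one, Matrix.vecMul_one] at this
    exact hv this

theorem J_le_comap_act : J p ≤ (J p).comap (act p g) := by
  have hp2 := hp.out.two_le
  nth_rw 1 [J_eq_span_smallGens]
  rw [Ideal.span_le]
  rintro f (rfl | rfl | rfl)
  · change act p g (delta p) ∈ J p
    rw [act_delta]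
    exact delta_mem_J p
  · exact act_gam_two_mem_J g
  · exact mem_J_of_isHomogeneous_of_le
      (isHomogeneous_act g (isHomogeneous_mon p (p - 1) (2 * p - 2))) (by omega)

open Matrix in
theorem pointSum_act (f : P p) : pointSum p (act p g f) = pointSum p f := by
  simp only [pointSum_apply, eval_act]
  refine Fintype.sum_equiv ⟨fun v => v ᵥ* g.1, fun v => v ᵥ* (g⁻¹).1, fun v => ?_, fun v => ?_⟩
    _ _ fun v => rfl
  · simpa using vecMul_coe_inv g⁻¹ v
  · exact vecMul_coe_inv g v

end Action

/-! ### Vanishing of invariants of positive degree -/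

section Invariants

variable {p : ℕ} [hp : Fact p.Prime]

open Matrix in
theorem exists_vecMul_eq {v : Fin 2 → ZMod p} (hv : v ≠ 0) :
    ∃ g : SpecialLinearGroup (Fin 2) (ZMod p), ![1, 0] ᵥ* g.1 = v := by
  by_cases h : v 0 = 0
  · have h1 : v 1 ≠ 0 := fun h1 => hv (funext fun i => by fin_cases i <;> simp [h, h1])
    refine ⟨⟨!![0, v 1; -(v 1)⁻¹, 0], by simp [det_fin_two_of, h1]⟩, ?_⟩
    ext i
    fin_cases i <;> simp [vecMul, dotProduct, Fin.sum_univ_two, h]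
  · refine ⟨⟨!![v 0, v 1; 0, (v 0)⁻¹], by simp [det_fin_two_of, h]⟩, ?_⟩
    ext i
    fin_cases i <;> simp [vecMul, dotProduct, Fin.sum_univ_two]

theorem mem_J_of_invariant_of_lt {f : P p} {d : ℕ} (hf : f.IsHomogeneous d) (hd0 : d ≠ 0)
    (hd : d < 2 * p - 2) (hinv : ∀ g, act p g f - f ∈ J p) : f ∈ J p := by
  have hconst : ∀ v : Fin 2 → ZMod p, v ≠ 0 → eval v f = eval ![1, 0] f := by
    intro v hv
    obtain ⟨g, rfl⟩ := exists_vecMul_eq hv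
    have h := eval_homogeneousComponent_of_mem_J hd (hinv g) ![1, 0]
    rw [homogeneousComponent_eq_self ((isHomogeneous_act g hf).sub hf), map_sub, eval_act,
      sub_eq_zero] at h
    exact h
  have h0 := eval_zero_of_isHomogeneous hf hd0
  have hC : eval ![1, 0] f = 0 := by
    -- Only the origin contributes to this sum, yet it is also p² times a constant minus the point
    -- sum of f, hence 0.
    have h1 : ∑ v : Fin 2 → ZMod p, (eval ![1, 0] f - eval v f) = eval ![1, 0] f := by
      rw [Finset.sum_eq_single 0, h0, sub_zero]
      · intro v _ hv
        rw [hconst v hv, sub_self]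
      · simp
    rw [Finset.sum_sub_distrib, ← pointSum_apply, pointSum_eq_zero hf hd] at h1
    simpa using h1.symm
  refine mem_J_of_forall_eval_eq_zero hf hd fun v => ?_
  by_cases hv : v = 0
  · rw [hv, h0]
  · rw [hconst v hv, hC]

/-- An invariant linear functional on the binary forms of degree `1 ≤ m < p` is zero. -/
theorem invariant_functional_eq_zero {m : ℕ} (hm : 1 ≤ m) (hmp : m ≤ p - 1)
    (ψ : P p →ₗ[ZMod p] ZMod p)
    (hψ : ∀ g, ∀ h : P p, h.IsHomogeneous m → ψ (act p g h) = ψ h) {k : ℕ} (hk : k ≤ m) :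
    ψ (mon p k (m - k)) = 0 := by
  have hp2 := hp.out.two_le
  have hy : (y p ^ m).IsHomogeneous m := isHomogeneous_X_pow _ _
  -- Invariance under the transvection y ↦ tx + y, expanded binomially.
  have hshift : ∀ t : ZMod p,
      ∑ i ∈ Finset.range (m + 1), t ^ i * ((m.choose i : ZMod p) * ψ (mon p i (m - i))) =
        ψ (y p ^ m) := by
    intro t
    obtain ⟨g, hg⟩ : ∃ g : Matrix.SpecialLinearGroup (Fin 2) (ZMod p), g.1 = !![1, t; 0, 1] :=
      ⟨⟨_, by simp [Matrix.det_fin_two_of]⟩, rfl⟩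
    rw [← hψ g _ hy, map_pow, act_y, hg, add_pow, map_sum]
    refine Finset.sum_congr rfl fun i _ => ?_
    rw [← smul_eq_mul, ← smul_eq_mul, smul_smul, ← map_smul]
    congr 1
    simp [mon, smul_eq_C_mul, mul_pow]
    ring
  have hpos : ∀ k, 1 ≤ k → k ≤ m → ψ (mon p k (m - k)) = 0 := by
    intro k hk1 hkm
    -- Weighting by t^(p-1-k) and summing over t isolates the coefficient of t^k; the right side
    -- vanishes since k ≥ 1.
    have h1 : ∑ i ∈ Finset.range (m + 1),
        powerSum p (i + (p - 1 - k)) * ((m.choose i : ZMod p) * ψ (mon p i (m - i))) =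
          powerSum p (p - 1 - k) * ψ (y p ^ m) := by
      simp only [powerSum, Finset.sum_mul]
      rw [Finset.sum_comm]
      refine Finset.sum_congr rfl fun t _ => ?_
      rw [← hshift t, Finset.mul_sum]
      exact Finset.sum_congr rfl fun i _ => by ring
    rw [powerSum_eq_zero (n := p - 1 - k) (by omega) (by omega), zero_mul,
      Finset.sum_eq_single_of_mem k (Finset.mem_range.2 (by omega)),
      show k + (p - 1 - k) = p - 1 by omega, powerSum_sub_one] at h1
    · have hc : (m.choose k : ZMod p) ≠ 0 := by
        rw [Ne, ZMod.natCast_eq_zero_iff]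
        intro hdvd
        have h2 := Nat.choose_mul_factorial_mul_factorial hkm
        have h3 : p ∣ m.factorial := by
          rw [← h2, mul_assoc]
          exact hdvd.mul_right _
        have := hp.out.dvd_factorial.1 h3
        omega
      simpa [hc] using h1
    · intro i hi hik
      have := Finset.mem_range.1 hi
      rw [powerSum_eq_zero (by omega) (by omega), zero_mul]
  rcases Nat.eq_zero_or_pos k with rfl | hk0
  -- This element sends y to x, reducing y^m to the case k = m.
  · obtain ⟨g, hg⟩ : ∃ g : Matrix.SpecialLinearGroup (Fin 2) (ZMod p), g.1 = !![0, 1; -1, 0] :=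
      ⟨⟨_, by simp [Matrix.det_fin_two_of]⟩, rfl⟩
    have h1 := hψ g _ hy
    rw [map_pow, act_y, hg] at h1
    have h2 := hpos m hm le_rfl
    simp only [mon, Nat.sub_self, pow_zero, mul_one] at h2
    simp only [mon, Nat.sub_zero, pow_zero, one_mul]
    rw [← h1]
    simpa using h2
  · exact hpos k hk0 hk

/-- Invariance of f modulo J and of the point sum makes h ↦ ∑ f(v)h(v) an invariant functional on
forms of degree m ≤ p - 1. -/
theorem mem_J_of_invariant_of_ge {f : P p} {d m : ℕ} (hf : f.IsHomogeneous d)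
    (hd : 2 * p - 2 ≤ d) (hm : 1 ≤ m) (hdm : d + m = 3 * p - 3)
    (hinv : ∀ g, act p g f - f ∈ J p) : f ∈ J p := by
  refine mem_J_of_pointSum_mul_eq_zero hf hd hm hdm fun k hk => ?_
  refine invariant_functional_eq_zero hm (by omega)
    (pointSum p ∘ₗ LinearMap.mulLeft (ZMod p) f) (fun g h hh => ?_) hk
  have h1 := pointSum_homogeneousComponent_mul_of_mem_J hm hdm (isHomogeneous_act g hh) (hinv g)
  rw [homogeneousComponent_eq_self ((isHomogeneous_act g hf).sub hf), sub_mul, map_sub,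
    ← map_mul, pointSum_act, sub_eq_zero] at h1
  exact h1.symm

theorem mem_J_of_invariant {f : P p} (hf : constantCoeff f = 0)
    (hinv : ∀ g, act p g f - f ∈ J p) : f ∈ J p := by
  have hp2 := hp.out.two_le
  let _ := MvPolynomial.gradedAlgebra (σ := Fin 2) (R := ZMod p)
  -- J has homogeneous generators, so invariance modulo J passes to each homogeneous component.
  have hJ : (J p).IsHomogeneous (homogeneousSubmodule (Fin 2) (ZMod p)) := by
    rw [J_eq_span_smallGens]
    refine Ideal.homogeneous_span _ _ ?_
    rintro q (rfl | rfl | rfl)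
    exacts [⟨_, isHomogeneous_delta p⟩, ⟨_, isHomogeneous_gam_two p⟩,
      ⟨_, isHomogeneous_mon p (p - 1) (2 * p - 2)⟩]
  rw [← sum_homogeneousComponent f]
  refine Ideal.sum_mem _ fun d _ => ?_
  have hd := homogeneousComponent_isHomogeneous d f
  have hdinv : ∀ g, act p g (homogeneousComponent d f) - homogeneousComponent d f ∈ J p := by
    intro g
    rw [← homogeneousComponent_act, ← map_sub]
    exact homogeneousComponent_mem_of_mem hJ (hinv g) d
  rcases Nat.eq_zero_or_pos d with rfl | hd0
  · rw [homogeneousComponent_zero, ← constantCoeff_eq, hf, C_0]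
    exact zero_mem _
  rcases lt_or_ge d (2 * p - 2) with h | h
  · exact mem_J_of_invariant_of_lt hd hd0.ne' h hdinv
  rcases lt_or_ge d (3 * p - 3) with h' | h'
  · exact mem_J_of_invariant_of_ge hd h (m := 3 * p - 3 - d) (by omega) (by omega) hdinv
  · exact mem_J_of_isHomogeneous_of_le hd h'

end Invariants

end StableInv

end

theorem mainTheorem10 (p : ℕ) [Fact p.Prime] :
    -- the two quotients of `P` coincide
    StableInv.J p =
        Ideal.span {StableInv.d1 p, StableInv.delta p, StableInv.gam p 2,
          StableInv.x p ^ (p - 1) * StableInv.y p ^ (2 * p - 2)} ∧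
    -- the classes of the monomials in `Θ` form a basis of `Q`
    (∃ b : Module.Basis (StableInv.Theta p) (ZMod p) (StableInv.Q p),
      ∀ t : StableInv.Theta p,
        b t = Ideal.Quotient.mk (StableInv.J p)
          (StableInv.x p ^ t.1.1 * StableInv.y p ^ t.1.2)) ∧
    -- the action of `SL_2(𝔽_p)` descends to `Q`, and an invariant element of `Q` all of whose
    -- homogeneous components have positive degree is zero
    (∃ hJ : ∀ g : Matrix.SpecialLinearGroup (Fin 2) (ZMod p),
        StableInv.J p ≤ (StableInv.J p).comap (StableInv.act p g),
      ∀ f : StableInv.P p, MvPolynomial.constantCoeff f = 0 →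
        (∀ g : Matrix.SpecialLinearGroup (Fin 2) (ZMod p),
          Ideal.quotientMapₐ (StableInv.J p) (StableInv.act p g) (hJ g)
            (Ideal.Quotient.mk (StableInv.J p) f) = Ideal.Quotient.mk (StableInv.J p) f) →
        Ideal.Quotient.mk (StableInv.J p) f = 0) :=
  ⟨StableInv.J_eq_span p, StableInv.exists_basis_Theta p, fun g => StableInv.J_le_comap_act g,
    fun _ hf hinv => Ideal.Quotient.eq_zero_iff_mem.2
      (StableInv.mem_J_of_invariant hf fun g => Ideal.Quotient.eq.1 (hinv g))⟩
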